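/- Let $\mathbb H$ be the space of quaternions with its Euclidean inner product $g$, let $\Gamma\subset\mathbb H$ be a lattice (a discrete subgroup spanning $\mathbb H$ over $\mathbb R$), and let $M=\mathbb H/\Gamma$ be the quotient torus of real dimension $4$, with projection $p:\mathbb H\to M$ and with all tangent spaces identified with $\mathbb H$ by translations. Let $\omega(u,v)=g(ui,v)$ and $$\hat\omega_I(u,v)=g(iu,v),\qquad \hat\omega_J(u,v)=g(ju,v),\qquad \hat\omega_K(u,v)=g(ku,v),$$ let $\omega_M$ be the symplectic form on $M$ induced by $\omega$, and put $\sigma=\tfrac12\,\omega\wedge\omega$. A Euclidean simplex of $M$ is the image $\sigma_0=p(\tilde\sigma)$ of the convex hull $\tilde\sigma\subset\mathbb H$ of finitely many affinely independent points such that $p|_{\tilde\sigma}$ is injective; its faces are the images of the faces of $\tilde\sigma$. A Euclidean triangulation $\mathscr T$ of $M$ is a finite set of Euclidean simplices covering $M$, closed under taking faces, such that any two simplices that meet intersect in a common face. Let $M'$ be the complement of its $3$-skeleton (the union of the simplices of dimension at most $3$). A continuous map $f:M\to M$ is polyhedral (with respect to $\mathscr T$) if for every simplex $p(\tilde\sigma)$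 of $\mathscr T$ there is an affine map $A:\mathbb H\to\mathbb H$ with $f\circ p=p\circ A$ on $\tilde\sigma$. On $M'$ such a map has a locally constant differential $\mathscr Df$ with values in $\mathrm{End}_{\mathbb R}(\mathbb H)$ (the linear parts of these affine maps). It is called a symplectic polyhedral map if moreover $f^*\omega_M=\omega_M$ on $M'$. The hyperKähler moment map is $\boldsymbol\mu=(\mu_I,\mu_J,\mu_K)$, where $$\mu_\bullet(F)=-\frac{F^*\omega\wedge\hat\omega_\bullet}{\sigma}\qquad(\bullet=I,J,K)$$ is a function on $M'$ for every locally constant $F:M'\to\mathrm{End}_{\mathbb R}(\mathbb H)$. Let $f:M\to M$ be a polyhedral map with respect to $\mathscr T$ such that $f^*[\omega_M]=[\omega_M]$ in the de Rham cohomology $H^2(M,\mathbb R)$, where $f^*$ is the map induced in cohomology by the continuous map $f$ (that is, by any smooth map homotopic to $f$). If $\boldsymbol\mu(\mathscr Df)=0$ on $M'$, then $f^*\omega_M=\omega_M$ on $M'$; that is, $f$ is a symplectic polyhedral map. -/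

import Mathlib

open scoped Quaternion Topology ContDiff RealInnerProductSpace

noncomputable section

namespace PolyTorus

/-! ### The flat hyperkähler structure of the quaternions -/

/-- Multiplication by the quaternion `q` on the left, as a real linear map. -/
def leftMul (q : ℍ) : ℍ →L[ℝ] ℍ := ContinuousLinearMap.mul ℝ ℍ q

/-- Multiplication by the quaternion `q` on the right, as a real linear map. -/
def rightMul (q : ℍ) : ℍ →L[ℝ] ℍ := (ContinuousLinearMap.mul ℝ ℍ).flip q

def qi : ℍ := ⟨0, 1, 0, 0⟩
def qj : ℍ := ⟨0, 0, 1, 0⟩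
def qk : ℍ := ⟨0, 0, 0, 1⟩

theorem inner_leftMul_self (q : ℍ) (hq : q.re = 0) (v : ℍ) : ⟪leftMul q v, v⟫ = 0 := by
  simp only [leftMul, ContinuousLinearMap.mul_apply', Quaternion.inner_def, Quaternion.re_mul,
    Quaternion.imI_mul, Quaternion.imJ_mul, Quaternion.imK_mul, Quaternion.re_star,
    Quaternion.imI_star, Quaternion.imJ_star, Quaternion.imK_star, hq]
  ring

theorem inner_rightMul_self (q : ℍ) (hq : q.re = 0) (v : ℍ) : ⟪rightMul q v, v⟫ = 0 := by
  simp only [rightMul, ContinuousLinearMap.flip_apply, ContinuousLinearMap.mul_apply',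
    Quaternion.inner_def, Quaternion.re_mul,
    Quaternion.imI_mul, Quaternion.imJ_mul, Quaternion.imK_mul, Quaternion.re_star,
    Quaternion.imI_star, Quaternion.imJ_star, Quaternion.imK_star, hq]
  ring

/-- The alternating form `(u, v) ↦ g(A u, v)` of a skew-symmetric endomorphism `A`. -/
def kahlerForm (A : ℍ →L[ℝ] ℍ) (hA : ∀ v, ⟪A v, v⟫ = 0) : ℍ [⋀^Fin 2]→L[ℝ] ℝ where
  toFun v := ⟪A (v 0), v 1⟫
  map_update_add' v i x y := by
    fin_cases i <;> simp [Function.update, inner_add_left, inner_add_right]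
  map_update_smul' v i c x := by
    fin_cases i <;> simp [Function.update, inner_smul_left, inner_smul_right]
  cont := by fun_prop
  map_eq_zero_of_eq' v i j h hij := by
    have h01 : v 0 = v 1 := by
      fin_cases i <;> fin_cases j <;> simp_all
    simp [h01, hA]

/-- `ω_V = g(i ·, ·)`, where the complex structure `i` is the quaternionic multiplication by `i`
on the right. -/
def omegaV : ℍ [⋀^Fin 2]→L[ℝ] ℝ := kahlerForm (rightMul qi) (inner_rightMul_self qi rfl)

/-- `ω̂_I = g(I ·, ·)`, where `I` is the quaternionic multiplication by `i` on the left. -/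
def omegaI : ℍ [⋀^Fin 2]→L[ℝ] ℝ := kahlerForm (leftMul qi) (inner_leftMul_self qi rfl)

/-- `ω̂_J = g(J ·, ·)`, where `J` is the quaternionic multiplication by `j` on the left. -/
def omegaJ : ℍ [⋀^Fin 2]→L[ℝ] ℝ := kahlerForm (leftMul qj) (inner_leftMul_self qj rfl)

/-- `ω̂_K = g(K ·, ·)`, where `K` is the quaternionic multiplication by `k` on the left. -/
def omegaK : ℍ [⋀^Fin 2]→L[ℝ] ℝ := kahlerForm (leftMul qk) (inner_leftMul_self qk rfl)

/-- The wedge product of two `2`-forms, as the sum over `(2,2)`-shuffles, evaluated on four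
vectors. -/
def wedge (a b : ℍ [⋀^Fin 2]→L[ℝ] ℝ) (v : Fin 4 → ℍ) : ℝ :=
  a ![v 0, v 1] * b ![v 2, v 3] - a ![v 0, v 2] * b ![v 1, v 3]
    + a ![v 0, v 3] * b ![v 1, v 2] + a ![v 1, v 2] * b ![v 0, v 3]
    - a ![v 1, v 3] * b ![v 0, v 2] + a ![v 2, v 3] * b ![v 0, v 1]

/-- The volume form `σ = ω_V ∧ ω_V / 2`. -/
def sigmaV (v : Fin 4 → ℍ) : ℝ := wedge omegaV omegaV v / 2

/-- The moment map density `-(F^*ω_V ∧ ω̂) / σ` at a point where the `ℍ`-valued `1`-form is `F`.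
The quotient of the two `4`-forms is computed on the frame `1, i, j, k`. -/
def moment (omegaHat : ℍ [⋀^Fin 2]→L[ℝ] ℝ) (F : ℍ →L[ℝ] ℍ) : ℝ :=
  -(wedge (omegaV.compContinuousLinearMap F) omegaHat ![1, qi, qj, qk]
      / sigmaV ![1, qi, qj, qk])

/-- The hyperkähler moment map `𝛍 = (μ_I, μ_J, μ_K)`, at one point. -/
def hyperMoment (F : ℍ →L[ℝ] ℍ) : ℝ × ℝ × ℝ :=
  (moment omegaI F, moment omegaJ F, moment omegaK F)

/-! ### The torus, its differential forms and maps -/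

/-- The torus `M = V / Γ`. -/
abbrev Torus (Γ : Submodule ℤ ℍ) : Type := ℍ ⧸ Γ.toAddSubgroup

variable (Γ : Submodule ℤ ℍ)

/-- The projection `p : V → M`. -/
def proj (x : ℍ) : Torus Γ := QuotientAddGroup.mk x

/-- `k`-forms on `M`, with the tangent spaces of `M` identified with `ℍ` by translations. -/
abbrev TorusForm (k : ℕ) : Type := Torus Γ → ℍ [⋀^Fin k]→L[ℝ] ℝ

/-- A `k`-form on `M` is smooth if its pullback to `V` is. -/
def IsSmoothForm {k : ℕ} (η : TorusForm Γ k) : Prop := ContDiff ℝ ∞ (fun x => η (proj Γ x))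

/-- `[α] = [β]` in de Rham cohomology: `α - β = dη` for some smooth form `η` on `M`. -/
def Cohomologous {k : ℕ} (α β : TorusForm Γ (k + 1)) : Prop :=
  ∃ η : TorusForm Γ k, IsSmoothForm Γ η ∧
    ∀ x : ℍ, α (proj Γ x) - β (proj Γ x) = extDeriv (fun y => η (proj Γ y)) x

/-- The tangent map of `f : M → M` at `x` is `L : ℍ → ℍ`: some local lift `g` of `f` to `V`
has derivative `L` at a point above `x`. -/
def HasTorusDerivAt (f : Torus Γ → Torus Γ) (x : Torus Γ) (L : ℍ →L[ℝ] ℍ) : Prop :=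
  ∃ (x' : ℍ) (g : ℍ → ℍ), proj Γ x' = x ∧ (∀ᶠ y in 𝓝 x', proj Γ (g y) = f (proj Γ y)) ∧
    HasFDerivAt g L x'

open Classical in
/-- The differential `𝒟f`, an `ℍ`-valued `1`-form (with the value `0` at the points where `f`
is not differentiable). -/
def torusDeriv (f : Torus Γ → Torus Γ) (x : Torus Γ) : ℍ →L[ℝ] ℍ :=
  if h : ∃ L, HasTorusDerivAt Γ f x L then h.choose else 0

/-- The pullback `f^*α` of a form on `M`. -/
def pullback {k : ℕ} (f : Torus Γ → Torus Γ) (α : TorusForm Γ k) : TorusForm Γ k :=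
  fun x => (α (f x)).compContinuousLinearMap (torusDeriv Γ f x)

/-- The symplectic form `ω_M`. -/
def omegaM : TorusForm Γ 2 := fun _ => omegaV

/-- A map `M → M` is smooth if it has a smooth lift `V → V`. -/
def IsSmoothMap (g : Torus Γ → Torus Γ) : Prop :=
  ∃ g' : ℍ → ℍ, ContDiff ℝ ∞ g' ∧ ∀ x, g (proj Γ x) = proj Γ (g' x)

/-- `f^*[α] = [β]` in the de Rham cohomology of `M`, for a continuous map `f`. The map induced by
`f` in cohomology is the one induced by any smooth map homotopic to `f`. -/
def PullbackClassEq {k : ℕ} (f : C(Torus Γ, Torus Γ)) (α β : TorusForm Γ (k + 1)) : Prop :=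
  ∃ g : C(Torus Γ, Torus Γ), IsSmoothMap Γ g ∧ f.Homotopic g ∧
    Cohomologous Γ (pullback Γ g α) β

/-! ### Euclidean triangulations and polyhedral maps -/

/-- The convex hull of `s` is a Euclidean simplex of `V` that `p` maps bijectively to `σ`. (The map
is then a diffeomorphism, since `p` is a local isometry and a simplex is compact.) -/
def IsSimplexLift (s : Finset ℍ) (σ : Set (Torus Γ)) : Prop :=
  s.Nonempty ∧ AffineIndependent ℝ ((↑) : s → ℍ) ∧
    Set.BijOn (proj Γ) (convexHull ℝ (s : Set ℍ)) σ

/-- `σ` is a Euclidean `k`-simplex of `M`. -/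
def IsEuclideanSimplex (k : ℕ) (σ : Set (Torus Γ)) : Prop :=
  ∃ s : Finset ℍ, s.card = k + 1 ∧ IsSimplexLift Γ s σ

/-- `τ` is a face (possibly not proper) of the Euclidean simplex `σ`. -/
def IsFace (τ σ : Set (Torus Γ)) : Prop :=
  ∃ s : Finset ℍ, IsSimplexLift Γ s σ ∧ ∃ t ⊆ s, IsSimplexLift Γ t τ

/-- A Euclidean triangulation of `M`: a finite simplicial decomposition into Euclidean simplices. -/
structure EuclideanTriangulation where
  cells : Set (Set (Torus Γ))
  finite : cells.Finite
  simplex : ∀ σ ∈ cells, ∃ k, IsEuclideanSimplex Γ k σ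
  face_mem : ∀ σ ∈ cells, ∀ τ, IsFace Γ τ σ → τ ∈ cells
  inter_face : ∀ σ ∈ cells, ∀ τ ∈ cells, (σ ∩ τ).Nonempty →
    IsFace Γ (σ ∩ τ) σ ∧ IsFace Γ (σ ∩ τ) τ
  cover : ⋃₀ cells = Set.univ

variable {Γ}

/-- The `k`-skeleton: the union of the cells of dimension at most `k`. -/
def EuclideanTriangulation.skeleton (T : EuclideanTriangulation Γ) (k : ℕ) : Set (Torus Γ) :=
  ⋃₀ {σ ∈ T.cells | ∃ m ≤ k, IsEuclideanSimplex Γ m σ}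

/-- `f : M → M` is polyhedral: its restriction to every simplex has an affine lift to `V`. -/
def IsPolyhedral (T : EuclideanTriangulation Γ) (f : C(Torus Γ, Torus Γ)) : Prop :=
  ∀ σ ∈ T.cells, ∃ s : Finset ℍ, IsSimplexLift Γ s σ ∧
    ∃ A : ℍ →ᵃ[ℝ] ℍ, ∀ x ∈ convexHull ℝ (s : Set ℍ), f (proj Γ x) = proj Γ (A x)

/-- A symplectic polyhedral map: a polyhedral map with `f^*ω_M = ω_M` off the `3`-skeleton. -/
def IsSymplecticPolyhedral (T : EuclideanTriangulation Γ) (f : C(Torus Γ, Torus Γ)) : Prop :=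
  IsPolyhedral T f ∧ ∀ x ∉ T.skeleton 3, pullback Γ f (omegaM Γ) x = omegaM Γ x

end PolyTorus

end

/-!
A polyhedral map `f` lifts to a Lipschitz map `F : ℍ → ℍ`, which differs by a `Γ`-periodic map from
the linear map `L` induced by `f` on `Γ`. The `2`-form `β = f^*ω - ω` is wedge-orthogonal to `ω̂_I`,
`ω̂_J` and `ω̂_K`, i.e. it is self-dual, so `β ∧ β` is a nonnegative multiple of `σ` that vanishes
only where `β` does. The coefficient of `β ∧ β` is a combination of minors of `DF`, and minors are
null Lagrangians: their mean over a fundamental domain depends only on `L`. Since `f^*[ω] = [ω]`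
says that `L` preserves `ω`, the mean of `β ∧ β` is the value at `L`, namely `0`. Hence `β = 0`
almost everywhere, and then at every point off the `3`-skeleton, where `DF` is locally constant.

The determinant is a null Lagrangian even for merely Lipschitz maps: for small `ε` the map
`id + ε F` is a homeomorphism which is equivariant for the translations by `Γ` up to the linear map
`id + ε L`, so by the change of variables formula the mean of `det (id + ε DF)` is
`det (id + ε L)`. Both sides are polynomials in `ε`, and `det DF`, `det L` are recovered from them
by interpolation.
-/

noncomputable section

open MeasureTheory Set Filter
open scoped NNReal ENNReal Pointwise

namespace PolyTorus

section Periods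

variable {E W W' : Type*} [NormedAddCommGroup E] [NormedSpace ℝ E]
  [NormedAddCommGroup W] [NormedSpace ℝ W] [NormedAddCommGroup W'] [NormedSpace ℝ W']
  {Γ : Submodule ℤ E} {F G : E → W} {L M : E →L[ℝ] W}

/-- `F` is quasi-periodic: the translation by a vector `γ` of `Γ` adds the constant `L γ` to `F`.
Maps with periods `L` are the lifts of the maps between tori acting by `L` on the first homology. -/
def HasPeriods (Γ : Submodule ℤ E) (F : E → W) (L : E →L[ℝ] W) : Prop :=
  ∀ x, ∀ γ ∈ Γ, F (x + γ) = F x + L γ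

theorem hasPeriods_clm (L : E →L[ℝ] W) : HasPeriods Γ L L :=
  fun x γ _ => map_add L x γ

theorem HasPeriods.add (hF : HasPeriods Γ F L) (hG : HasPeriods Γ G M) :
    HasPeriods Γ (fun x => F x + G x) (L + M) := fun x γ hγ => by
  simp only [hF x γ hγ, hG x γ hγ, add_apply, add_add_add_comm]

theorem HasPeriods.clm_comp (hF : HasPeriods Γ F L) (Q : W →L[ℝ] W') :
    HasPeriods Γ (fun x => Q (F x)) (Q ∘L L) := fun x γ hγ => by
  simp only [hF x γ hγ, map_add, ContinuousLinearMap.comp_apply]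

theorem HasPeriods.fderiv_add (hF : HasPeriods Γ F L) (x : E) {γ : E} (hγ : γ ∈ Γ) :
    fderiv ℝ F (x + γ) = fderiv ℝ F x := by
  rw [← fderiv_comp_add_right, funext fun y => hF y γ hγ, fderiv_add_const]

end Periods

section SmallPerturbation

variable {E : Type*} [NormedAddCommGroup E] [NormedSpace ℝ E] [FiniteDimensional ℝ E]

theorem exists_homeomorph_id_add {F : E → E} {K : ℝ≥0} (hF : LipschitzWith K F) (hK : K < 1) :
    ∃ H : E ≃ₜ E, ⇑H = fun x => x + F x := by
  have happrox : ApproximatesLinearOn (fun x => x + F x)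
      (ContinuousLinearEquiv.refl ℝ E : E →L[ℝ] E) univ K := by
    rw [ApproximatesLinearOn.approximatesLinearOn_iff_lipschitzOnWith, lipschitzOnWith_univ]
    convert hF using 1
    funext x
    exact add_sub_cancel_left x (F x)
  have hsmall : Subsingleton E ∨
      K < ‖((ContinuousLinearEquiv.refl ℝ E).symm : E →L[ℝ] E)‖₊⁻¹ := by
    refine (subsingleton_or_nontrivial E).imp_right fun (_ : Nontrivial E) => ?_
    rwa [ContinuousLinearEquiv.refl_symm, ContinuousLinearEquiv.coe_refl,
      ContinuousLinearMap.nnnorm_id, inv_one]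
  exact ⟨happrox.toHomeomorph _ hsmall, rfl⟩

theorem isUnit_id_add {A : E →L[ℝ] E} (hA : ‖A‖ < 1) :
    IsUnit (ContinuousLinearMap.id ℝ E + A) := by
  have : CompleteSpace E := FiniteDimensional.complete ℝ E
  simpa [ContinuousLinearMap.one_def] using
    isUnit_one_sub_of_norm_lt_one (x := -A) (by rwa [norm_neg])

theorem det_id_add_pos {A : E →L[ℝ] E} (hA : ‖A‖ < 1) :
    0 < (ContinuousLinearMap.id ℝ E + A).det := by
  have hne : ∀ t ∈ Icc (0 : ℝ) 1, (ContinuousLinearMap.id ℝ E + t • A).det ≠ 0 := by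
    intro t ht
    have hlt : ‖t • A‖ < 1 := by
      rw [norm_smul, Real.norm_of_nonneg ht.1]
      exact (mul_le_of_le_one_left (norm_nonneg A) ht.2).trans_lt hA
    exact (((isUnit_id_add hlt).map ContinuousLinearMap.toLinearMapRingHom).map
      LinearMap.det).ne_zero
  have hcont : ContinuousOn (fun t : ℝ => (ContinuousLinearMap.id ℝ E + t • A).det) (Icc 0 1) :=
    (ContinuousLinearMap.continuous_det.comp (by fun_prop)).continuousOn
  by_contra! hneg
  obtain ⟨t, ht, hdet⟩ := intermediate_value_Icc' zero_le_one hcont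
    (show (0 : ℝ) ∈ Icc _ _ by simpa [ContinuousLinearMap.det] using hneg)
  exact hne t ht hdet

theorem exists_det_eq_sum_det_id_add_smul {R : ℝ} (hR : 0 ≤ R) :
    ∃ (s : Finset ℝ) (w : ℝ → ℝ), (∀ c ∈ s, R < c) ∧ ∀ A : E →L[ℝ] E,
      A.det = ∑ c ∈ s, w c * (ContinuousLinearMap.id ℝ E + c⁻¹ • A).det := by
  obtain ⟨s, hs, hcard⟩ := (Ioi_infinite R).exists_subset_card_eq (Module.finrank ℝ E + 1)
  refine ⟨s, fun c => (Lagrange.basis s id c).eval 0 * c ^ Module.finrank ℝ E,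
    fun c hc => hs hc, fun A => ?_⟩
  set p := (-(A : E →ₗ[ℝ] E)).charpoly with hp
  have heval (t : ℝ) : p.eval t = (t • ContinuousLinearMap.id ℝ E + A).det := by
    rw [hp, LinearMap.eval_charpoly, ContinuousLinearMap.det]
    congr 1
    ext x
    simp [Algebra.algebraMap_eq_smul_one]
  have hdeg : p.degree < s.card := by
    rw [Polynomial.degree_eq_natDegree (LinearMap.charpoly_monic _).ne_zero,
      LinearMap.charpoly_natDegree, hcard]
    exact_mod_cast Nat.lt_succ_self _
  have hscale (c : ℝ) (hc : c ∈ s) : p.eval c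
      = c ^ Module.finrank ℝ E * (ContinuousLinearMap.id ℝ E + c⁻¹ • A).det := by
    have hc0 : c ≠ 0 := (hR.trans_lt (hs hc)).ne'
    rw [heval, ContinuousLinearMap.det, ContinuousLinearMap.det, ← LinearMap.det_smul]
    congr 1
    ext x
    simp [hc0]
  calc A.det = p.eval 0 := by rw [heval, zero_smul, zero_add]
    _ = ∑ c ∈ s, p.eval c * (Lagrange.basis s id c).eval 0 := by
        conv_lhs => rw [Lagrange.eq_interpolate (injOn_id _) hdeg]
        simp [Lagrange.interpolate_apply, Polynomial.eval_finsetSum]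
    _ = _ := Finset.sum_congr rfl fun c hc => by rw [hscale c hc]; ring

theorem det_id_add_comp_comm {W : Type*} [NormedAddCommGroup W] [NormedSpace ℝ W]
    [FiniteDimensional ℝ W] (A : E →L[ℝ] W) (U : W →L[ℝ] E) :
    (ContinuousLinearMap.id ℝ W + A ∘L U).det = (ContinuousLinearMap.id ℝ E + U ∘L A).det := by
  classical
  let e := Module.finBasis ℝ E
  let b := Module.finBasis ℝ W
  rw [ContinuousLinearMap.det, ContinuousLinearMap.det, ← LinearMap.det_toMatrix b,
    ← LinearMap.det_toMatrix e]
  simp only [ContinuousLinearMap.toLinearMap_add, ContinuousLinearMap.toLinearMap_comp,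
    ContinuousLinearMap.coe_id, map_add, LinearMap.toMatrix_id,
    LinearMap.toMatrix_comp b e b, LinearMap.toMatrix_comp e b e]
  exact Matrix.det_one_add_mul_comm _ _

end SmallPerturbation

section MeasureImage

variable {E : Type*} [NormedAddCommGroup E] [NormedSpace ℝ E] [FiniteDimensional ℝ E]
  [MeasurableSpace E] [BorelSpace E] (μ : Measure E) [μ.IsAddHaarMeasure]
  {F : E → E} {K : ℝ≥0}

theorem measure_image_eq_zero_of_lipschitzWith (hF : LipschitzWith K F) {s : Set E}
    (hs : μ s = 0) : μ (F '' s) = 0 := by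
  have hμ : μ ≪ Measure.hausdorffMeasure (Module.finrank ℝ E) :=
    Measure.absolutelyContinuous_isAddHaarMeasure _ _
  have hH : Measure.hausdorffMeasure (Module.finrank ℝ E) ≪ μ :=
    Measure.absolutelyContinuous_isAddHaarMeasure _ _
  apply hμ
  simpa [hH hs] using hF.hausdorffMeasure_image_le (Nat.cast_nonneg (Module.finrank ℝ E)) s

theorem lintegral_abs_det_fderiv_eq_measure_image (hF : LipschitzWith K F)
    (hinj : Function.Injective F) {s : Set E} (hs : NullMeasurableSet s μ) :
    ∫⁻ x in s, ENNReal.ofReal |(fderiv ℝ F x).det| ∂μ = μ (F '' s) := by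
  set S := {x | DifferentiableAt ℝ F x}
  have hS : μ Sᶜ = 0 := hF.ae_differentiableAt
  have hsS : (s ∩ S : Set E) =ᵐ[μ] s := inter_ae_eq_left_of_ae_eq_univ (ae_eq_univ.2 hS)
  have himage : μ (F '' (s ∩ S)) = μ (F '' s) := by
    refine measure_eq_measure_of_null_sdiff (image_mono inter_subset_left) ?_
    rw [← image_sdiff hinj, sdiff_self_inter]
    exact measure_mono_null (image_mono fun x hx => hx.2)
      (measure_image_eq_zero_of_lipschitzWith μ hF hS)
  rw [← setLIntegral_congr hsS, ← himage]
  exact lintegral_abs_det_fderiv_eq_addHaar_image₀ μ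
    (hs.inter (measurableSet_of_differentiableAt ℝ F).nullMeasurableSet)
    (fun x hx => hx.2.hasFDerivAt.hasFDerivWithinAt) hinj.injOn

variable {Γ : Submodule ℤ E} [Countable Γ] {D : Set E}

theorem measure_image_of_map_add (hD : IsAddFundamentalDomain Γ D μ) (H : E ≃ₜ E)
    (hH : LipschitzWith K H) (hΓ : ∀ x, ∀ γ ∈ Γ, H (x + γ) = H x + γ) :
    μ (H '' D) = μ D := by
  have hq : Measure.QuasiMeasurePreserving H.symm μ μ := by
    refine ⟨H.symm.continuous.measurable, fun s hs => ?_⟩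
    rw [show ⇑H.symm = H.symm.toMeasurableEquiv from rfl, MeasurableEquiv.map_apply]
    exact H.image_eq_preimage_symm s ▸ measure_image_eq_zero_of_lipschitzWith μ hH hs
  have hHD := hD.image_of_equiv H.toEquiv hq (Equiv.refl Γ) fun γ x => by
    change H ((γ : E) + x) = γ + H x
    rw [add_comm, hΓ x γ γ.2, add_comm]
  have : VAddInvariantMeasure Γ E μ := inferInstanceAs (VAddInvariantMeasure Γ.toAddSubgroup E μ)
  have : MeasurableConstVAdd Γ E := inferInstanceAs (MeasurableConstVAdd Γ.toAddSubgroup E)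
  exact hHD.measure_eq hD

theorem measure_image_of_hasPeriods (hD : IsAddFundamentalDomain Γ D μ) (H : E ≃ₜ E)
    (hH : LipschitzWith K H) (T : E ≃L[ℝ] E) (hΓ : HasPeriods Γ H (T : E →L[ℝ] E)) :
    μ (H '' D) = ENNReal.ofReal |(T : E →L[ℝ] E).det| * μ D := by
  have hvol := measure_image_of_map_add μ hD (H.trans T.symm.toHomeomorph)
    (T.symm.lipschitz.comp hH) fun x γ hγ => by
      simp [hΓ x γ hγ]
  rw [← hvol, ← Measure.addHaar_image_continuousLinearMap, ← image_comp]
  congr 2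
  funext x
  simp

theorem setIntegral_det_id_add_fderiv (hD : IsAddFundamentalDomain Γ D μ)
    (hF : LipschitzWith K F) (hK : K < 1) {L : E →L[ℝ] E} (hL : ‖L‖ < 1)
    (hΓ : HasPeriods Γ F L) :
    ∫ x in D, (ContinuousLinearMap.id ℝ E + fderiv ℝ F x).det ∂μ
      = μ.real D * (ContinuousLinearMap.id ℝ E + L).det := by
  obtain ⟨H, hH⟩ := exists_homeomorph_id_add hF hK
  obtain ⟨u, hu⟩ := isUnit_id_add hL
  have hHlip : LipschitzWith (1 + K) H := hH ▸ LipschitzWith.id.add hF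
  have hvol : μ (H '' D) = ENNReal.ofReal (ContinuousLinearMap.id ℝ E + L).det * μ D := by
    have hT : (ContinuousLinearEquiv.ofUnit u : E →L[ℝ] E) = ContinuousLinearMap.id ℝ E + L := hu
    rw [measure_image_of_hasPeriods μ hD H hHlip (ContinuousLinearEquiv.ofUnit u), hT,
      abs_of_pos (det_id_add_pos hL)]
    rw [hT, hH]
    exact (hasPeriods_clm (ContinuousLinearMap.id ℝ E)).add hΓ
  have hpos (x : E) : 0 < (ContinuousLinearMap.id ℝ E + fderiv ℝ F x).det :=
    det_id_add_pos ((norm_fderiv_le_of_lipschitz ℝ hF).trans_lt hK)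
  have hderiv : ∀ᵐ x ∂μ, ENNReal.ofReal |(fderiv ℝ H x).det|
      = ENNReal.ofReal (ContinuousLinearMap.id ℝ E + fderiv ℝ F x).det := by
    filter_upwards [hF.ae_differentiableAt] with x hx
    rw [hH, fderiv_fun_add differentiableAt_fun_id hx, fderiv_fun_id, abs_of_pos (hpos x)]
  have hmeas : Measurable fun x => (ContinuousLinearMap.id ℝ E + fderiv ℝ F x).det :=
    ContinuousLinearMap.continuous_det.measurable.comp ((measurable_fderiv ℝ F).const_add _)
  rw [integral_eq_lintegral_of_nonneg_ae (.of_forall fun x => (hpos x).le)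
      hmeas.aestronglyMeasurable, ← lintegral_congr_ae (ae_restrict_of_ae hderiv),
    lintegral_abs_det_fderiv_eq_measure_image μ hHlip H.injective hD.nullMeasurableSet, hvol,
    ENNReal.toReal_mul, ENNReal.toReal_ofReal (det_id_add_pos hL).le, mul_comm, Measure.real]

end MeasureImage

section NullLagrangian

variable {E W W' : Type*} [NormedAddCommGroup E] [NormedSpace ℝ E] [MeasurableSpace E]
  [NormedAddCommGroup W] [NormedSpace ℝ W] [NormedAddCommGroup W'] [NormedSpace ℝ W']
  {μ : Measure E} {Γ : Submodule ℤ E} {D : Set E}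

variable (μ Γ D) in
/-- `B` is a null Lagrangian: the integral of `B (DF)` over the fundamental domain `D` of `Γ`
depends only on the periods of the Lipschitz map `F`, so that it is the same as for the linear map
with these periods. -/
structure IsNullLagrangian (B : (E →L[ℝ] W) → ℝ) : Prop where
  continuous : Continuous B
  setIntegral_eq ⦃F : E → W⦄ ⦃K : ℝ≥0⦄ ⦃L : E →L[ℝ] W⦄ :
    LipschitzWith K F → HasPeriods Γ F L →
      ∫ x in D, B (fderiv ℝ F x) ∂μ = μ.real D * B L

namespace IsNullLagrangian

variable {B : (E →L[ℝ] W) → ℝ}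

theorem const (c : ℝ) : IsNullLagrangian μ Γ D fun _ : E →L[ℝ] W => c :=
  ⟨continuous_const, fun _ _ _ _ _ => by simp⟩

theorem const_mul (c : ℝ) (hB : IsNullLagrangian μ Γ D B) :
    IsNullLagrangian μ Γ D fun A => c * B A :=
  ⟨hB.continuous.const_mul c, fun F K L hF hL => by
    rw [integral_const_mul, hB.setIntegral_eq hF hL, mul_left_comm]⟩

end IsNullLagrangian

variable [FiniteDimensional ℝ E] [BorelSpace E]

theorem integrableOn_comp_fderiv [FiniteDimensional ℝ W] (hfin : μ D ≠ ⊤) {B : (E →L[ℝ] W) → ℝ}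
    (hB : Continuous B) {F : E → W} {K : ℝ≥0} (hF : LipschitzWith K F) :
    IntegrableOn (fun x => B (fderiv ℝ F x)) D μ := by
  have : CompleteSpace W := FiniteDimensional.complete ℝ W
  have : ProperSpace (E →L[ℝ] W) := FiniteDimensional.proper ℝ _
  obtain ⟨C, hC⟩ := (isCompact_closedBall (0 : E →L[ℝ] W) K).exists_bound_of_continuousOn
    hB.continuousOn
  refine IntegrableOn.of_bound hfin.lt_top
    (hB.measurable.comp (measurable_fderiv ℝ F)).aestronglyMeasurable C
    (.of_forall fun x => hC _ ?_)
  simpa using norm_fderiv_le_of_lipschitz ℝ hF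

theorem setIntegral_det_id_add_comp_fderiv [FiniteDimensional ℝ W] [μ.IsAddHaarMeasure]
    [Countable Γ] (hD : IsAddFundamentalDomain Γ D μ) {F : E → W} {K : ℝ≥0} {L : E →L[ℝ] W}
    (hF : LipschitzWith K F) (hL : HasPeriods Γ F L) (V : W →L[ℝ] E) (hVK : ‖V‖ * K < 1)
    (hVL : ‖V‖ * ‖L‖ < 1) :
    ∫ x in D, (ContinuousLinearMap.id ℝ E + V ∘L fderiv ℝ F x).det ∂μ
      = μ.real D * (ContinuousLinearMap.id ℝ E + V ∘L L).det := by
  rw [← setIntegral_det_id_add_fderiv μ hD (V.lipschitz.comp hF) (mod_cast hVK)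
    ((V.opNorm_comp_le L).trans_lt hVL) (hL.clm_comp V)]
  refine integral_congr_ae (ae_restrict_of_ae ?_)
  filter_upwards [hF.ae_differentiableAt] with x hx
  rw [(V.hasFDerivAt.comp x hx.hasFDerivAt).fderiv]

namespace IsNullLagrangian

variable {B C : (E →L[ℝ] W) → ℝ}

theorem add [FiniteDimensional ℝ W] (hfin : μ D ≠ ⊤) (hB : IsNullLagrangian μ Γ D B)
    (hC : IsNullLagrangian μ Γ D C) : IsNullLagrangian μ Γ D fun A => B A + C A :=
  ⟨hB.continuous.add hC.continuous, fun F K L hF hL => by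
    rw [integral_add (integrableOn_comp_fderiv hfin hB.continuous hF)
      (integrableOn_comp_fderiv hfin hC.continuous hF), hB.setIntegral_eq hF hL,
      hC.setIntegral_eq hF hL, mul_add]⟩

theorem sum [FiniteDimensional ℝ W] (hfin : μ D ≠ ⊤) {ι : Type*} (s : Finset ι)
    {B : ι → (E →L[ℝ] W) → ℝ} (hB : ∀ i ∈ s, IsNullLagrangian μ Γ D (B i)) :
    IsNullLagrangian μ Γ D fun A => ∑ i ∈ s, B i A :=
  ⟨continuous_finsetSum s fun i hi => (hB i hi).continuous, fun F K L hF hL => by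
    rw [integral_finsetSum s fun i hi => integrableOn_comp_fderiv hfin (hB i hi).continuous hF,
      Finset.mul_sum]
    exact Finset.sum_congr rfl fun i hi => (hB i hi).setIntegral_eq hF hL⟩

variable [μ.IsAddHaarMeasure]

theorem comp_left [FiniteDimensional ℝ W] {B : (E →L[ℝ] W') → ℝ} (hB : IsNullLagrangian μ Γ D B)
    (Q : W →L[ℝ] W') : IsNullLagrangian μ Γ D fun A : E →L[ℝ] W => B (Q ∘L A) where
  continuous := hB.continuous.comp (continuous_const.clm_comp continuous_id)
  setIntegral_eq F K L hF hL := by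
    rw [← hB.setIntegral_eq (Q.lipschitz.comp hF) (hL.clm_comp Q)]
    refine integral_congr_ae (ae_restrict_of_ae ?_)
    filter_upwards [hF.ae_differentiableAt] with x hx
    rw [(Q.hasFDerivAt.comp x hx.hasFDerivAt).fderiv]

variable [FiniteDimensional ℝ W] [Countable Γ]

theorem det_comp (hD : IsAddFundamentalDomain Γ D μ) (hfin : μ D ≠ ⊤) (U : W →L[ℝ] E) :
    IsNullLagrangian μ Γ D fun A : E →L[ℝ] W => (A ∘L U).det where
  continuous := ContinuousLinearMap.continuous_det.comp (continuous_id.clm_comp continuous_const)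
  setIntegral_eq F K L hF hL := by
    obtain ⟨s, w, hs, hdet⟩ := exists_det_eq_sum_det_id_add_smul (E := W)
      (R := ‖U‖ * max (K : ℝ) ‖L‖) (by positivity)
    have hdet' (A : E →L[ℝ] W) : (A ∘L U).det
        = ∑ c ∈ s, w c * (ContinuousLinearMap.id ℝ E + (c⁻¹ • U) ∘L A).det := by
      rw [hdet]
      exact Finset.sum_congr rfl fun c _ => by
        rw [← ContinuousLinearMap.comp_smul, det_id_add_comp_comm]
    have hsmall (c : ℝ) (hc : c ∈ s) (r : ℝ) (hr : r ≤ max (K : ℝ) ‖L‖) : ‖c⁻¹ • U‖ * r < 1 := by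
      have hUc : ‖U‖ * r < c := (mul_le_mul_of_nonneg_left hr (norm_nonneg U)).trans_lt (hs c hc)
      have hc0 : 0 < c := lt_of_le_of_lt (by positivity) (hs c hc)
      rwa [norm_smul, Real.norm_of_nonneg (inv_nonneg.2 hc0.le), mul_assoc,
        inv_mul_lt_one₀ hc0]
    simp_rw [hdet']
    rw [integral_finsetSum s fun c _ => (integrableOn_comp_fderiv hfin
      (B := fun A => (ContinuousLinearMap.id ℝ E + (c⁻¹ • U) ∘L A).det)
      (ContinuousLinearMap.continuous_det.comp (by fun_prop)) hF).const_mul _,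
      Finset.mul_sum]
    refine Finset.sum_congr rfl fun c hc => ?_
    rw [integral_const_mul, setIntegral_det_id_add_comp_fderiv hD hF hL _
      (hsmall c hc _ (le_max_left _ _)) (hsmall c hc _ (le_max_right _ _)), mul_left_comm]

theorem apply_real (hD : IsAddFundamentalDomain Γ D μ) (hfin : μ D ≠ ⊤) (u : E) :
    IsNullLagrangian μ Γ D fun A : E →L[ℝ] ℝ => A u := by
  convert det_comp hD hfin (ContinuousLinearMap.toSpanSingleton ℝ u) using 2 with A
  simp [ContinuousLinearMap.det, LinearMap.det_ring]

theorem continuousLinearMap (hD : IsAddFundamentalDomain Γ D μ) (hfin : μ D ≠ ⊤)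
    (φ : (E →L[ℝ] W) →L[ℝ] ℝ) : IsNullLagrangian μ Γ D φ := by
  let e := Module.finBasis ℝ E
  let b := Module.finBasis ℝ W
  let ℓ (i : Fin (Module.finrank ℝ W)) : W →L[ℝ] ℝ := (b.coord i).toContinuousLinearMap
  let m (j : Fin (Module.finrank ℝ E)) : E →L[ℝ] ℝ := (e.coord j).toContinuousLinearMap
  have hφ (A : E →L[ℝ] W) :
      φ A = ∑ i, ∑ j, φ ((m j).smulRight (b i)) * (ℓ i ∘L A) (e j) := by
    have hA : A = ∑ i, ∑ j, (ℓ i ∘L A) (e j) • (m j).smulRight (b i) := by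
      refine ContinuousLinearMap.coe_injective (e.ext fun j => ?_)
      conv_lhs => rw [ContinuousLinearMap.coe_coe, ← b.sum_repr (A (e j))]
      simp [ℓ, m, Finsupp.single_apply]
    conv_lhs => rw [hA]
    simp only [map_sum, map_smul, smul_eq_mul, mul_comm]
  rw [funext hφ]
  exact sum hfin _ fun i _ => sum hfin _ fun j _ =>
    ((apply_real hD hfin (e j)).comp_left (ℓ i)).const_mul _

end IsNullLagrangian

end NullLagrangian

section ConstantForms

section BasisExpansion

variable {R M N ι κ : Type*} [CommRing R] [AddCommGroup M] [Module R M] [AddCommGroup N]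
  [Module R N] [Fintype ι] [DecidableEq ι] [Fintype κ]

theorem multilinearMap_apply_eq_sum_basis (e : Module.Basis κ R M)
    (α : MultilinearMap R (fun _ : ι => M) N) (v : ι → M) :
    α v = ∑ f : ι → κ, (∏ j, e.repr (v j) (f j)) • α (e ∘ f) := by
  conv_lhs => rw [show v = fun j => ∑ k, e.repr (v j) k • e k from
    funext fun j => (e.sum_repr (v j)).symm, α.map_sum]
  exact Finset.sum_congr rfl fun f _ =>
    α.map_smul_univ (fun j => e.repr (v j) (f j)) (fun j => e (f j))

theorem factorial_smul_alternatingMap_apply (e : Module.Basis κ R M) (α : M [⋀^ι]→ₗ[R] N)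
    (v : ι → M) : (Fintype.card ι).factorial • α v
      = ∑ f : ι → κ, (Matrix.of fun i j => e.repr (v j) (f i)).det • α (e ∘ f) := by
  have hperm (σ : Equiv.Perm ι) : ∑ f : ι → κ,
      (σ.sign : ℤ) • (∏ j, e.repr (v j) (f (σ j))) • α (e ∘ f) = α v := by
    calc _ = ∑ f : ι → κ, (∏ j, e.repr (v j) ((f ∘ σ) j)) • α (e ∘ f ∘ σ) :=
          Finset.sum_congr rfl fun f _ => by
            rw [← Function.comp_assoc, α.map_perm, smul_comm]; rfl
      _ = ∑ f : ι → κ, (∏ j, e.repr (v j) (f j)) • α (e ∘ f) :=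
          (σ.arrowCongr (Equiv.refl κ)).symm.sum_comp
            fun f : ι → κ => (∏ j, e.repr (v j) (f j)) • α (e ∘ f)
      _ = α v := (multilinearMap_apply_eq_sum_basis e α.toMultilinearMap v).symm
  symm
  calc _ = ∑ f : ι → κ, ∑ σ : Equiv.Perm ι,
        (σ.sign : ℤ) • (∏ j, e.repr (v j) (f (σ j))) • α (e ∘ f) := by
        simp only [Matrix.det_apply, Finset.sum_smul, Matrix.of_apply, Units.smul_def, smul_assoc]
    _ = ∑ _ : Equiv.Perm ι, α v := by
        rw [Finset.sum_comm]
        exact Finset.sum_congr rfl fun σ _ => hperm σ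
    _ = _ := by rw [Finset.sum_const, Finset.card_univ, Fintype.card_perm]

end BasisExpansion

instance {E W ι : Type*} [NormedAddCommGroup E] [NormedSpace ℝ E] [FiniteDimensional ℝ E]
    [NormedAddCommGroup W] [NormedSpace ℝ W] [FiniteDimensional ℝ W] [Finite ι] :
    FiniteDimensional ℝ (E [⋀^ι]→L[ℝ] W) :=
  FiniteDimensional.of_injective
    (V₂ := MultilinearMap ℝ (fun _ : ι => E) W)
    ⟨⟨fun α => α.toMultilinearMap, fun _ _ => rfl⟩, fun _ _ => rfl⟩ fun _ _ h =>
      ContinuousAlternatingMap.ext fun v => DFunLike.congr_fun h v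

variable {E W : Type*} [NormedAddCommGroup E] [NormedSpace ℝ E] [FiniteDimensional ℝ E]
  [MeasurableSpace E] [BorelSpace E] [NormedAddCommGroup W] [NormedSpace ℝ W]
  [FiniteDimensional ℝ W] {μ : Measure E} [μ.IsAddHaarMeasure] {Γ : Submodule ℤ E} [Countable Γ]
  {D : Set E}

theorem IsNullLagrangian.det_of_basis_repr {ι κ : Type*} [Fintype ι] [DecidableEq ι]
    (hD : IsAddFundamentalDomain Γ D μ) (hfin : μ D ≠ ⊤) (b : Module.Basis κ ℝ W) (f : ι → κ)
    (v : ι → E) :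
    IsNullLagrangian μ Γ D fun A : E →L[ℝ] W =>
      (Matrix.of fun i j => b.repr (A (v j)) (f i)).det := by
  let V : (ι → ℝ) →L[ℝ] E := (Fintype.linearCombination ℝ v).toContinuousLinearMap
  let Q : W →L[ℝ] (ι → ℝ) :=
    (LinearMap.pi fun i => b.coord (f i)).toContinuousLinearMap
  convert (det_comp hD hfin V).comp_left Q using 2 with A
  rw [ContinuousLinearMap.det, ← LinearMap.det_toMatrix (Pi.basisFun ℝ ι)]
  congr 1
  ext i j
  simp [Q, V]

theorem IsNullLagrangian.compContinuousLinearMap {ι : Type*} [Finite ι]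
    (hD : IsAddFundamentalDomain Γ D μ) (hfin : μ D ≠ ⊤) (α : W [⋀^ι]→L[ℝ] ℝ) (v : ι → E) :
    IsNullLagrangian μ Γ D fun A : E →L[ℝ] W => α.compContinuousLinearMap A v := by
  classical
  have := Fintype.ofFinite ι
  let b := Module.finBasis ℝ W
  have hα (A : E →L[ℝ] W) : α.compContinuousLinearMap A v
      = ∑ f : ι → Fin (Module.finrank ℝ W), ((Fintype.card ι).factorial : ℝ)⁻¹ * α (b ∘ f) *
        (Matrix.of fun i j => b.repr (A (v j)) (f i)).det := by
    have h := factorial_smul_alternatingMap_apply b α.toAlternatingMap (A ∘ v)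
    simp only [nsmul_eq_mul, smul_eq_mul] at h
    rw [Finset.sum_congr rfl fun f _ => by rw [mul_assoc, mul_comm (α _)], ← Finset.mul_sum]
    exact (eq_inv_mul_iff_mul_eq₀ (mod_cast Nat.factorial_ne_zero _)).2 h
  rw [funext hα]
  exact sum hfin _ fun f _ => (det_of_basis_repr hD hfin b f v).const_mul _

theorem setIntegral_extDeriv_eq_zero (hD : IsAddFundamentalDomain Γ D μ) (hfin : μ D ≠ ⊤) {k : ℕ}
    {η : E → E [⋀^Fin k]→L[ℝ] ℝ} {K : ℝ≥0} (hη : LipschitzWith K η) (hΓ : HasPeriods Γ η 0)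
    (v : Fin (k + 1) → E) : ∫ x in D, extDeriv η x v ∂μ = 0 := by
  have hφ := IsNullLagrangian.continuousLinearMap hD hfin
    (ContinuousAlternatingMap.apply ℝ E ℝ v ∘L
      ContinuousAlternatingMap.alternatizeUncurryFinCLM ℝ E ℝ (n := k))
  exact (hφ.setIntegral_eq hη hΓ).trans (by rw [map_zero, mul_zero])

end ConstantForms

section Lattice

variable {E : Type*} [NormedAddCommGroup E]

theorem ae_of_ae_restrict_of_add_mem [MeasurableSpace E] [BorelSpace E] {μ : Measure E}
    [μ.IsAddLeftInvariant] {Γ : Submodule ℤ E} [Countable Γ] {D : Set E}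
    (hD : IsAddFundamentalDomain Γ D μ) {p : E → Prop}
    (hp : ∀ x, ∀ γ ∈ Γ, p (x + γ) ↔ p x) (h : ∀ᵐ x ∂μ.restrict D, p x) : ∀ᵐ x ∂μ, p x := by
  have : VAddInvariantMeasure Γ E μ := inferInstanceAs (VAddInvariantMeasure Γ.toAddSubgroup E μ)
  have : MeasurableConstVAdd Γ E := inferInstanceAs (MeasurableConstVAdd Γ.toAddSubgroup E)
  have hinv (γ : Γ) : γ +ᵥ {x | ¬ p x} = {x | ¬ p x} := by
    ext x
    rw [mem_vadd_set_iff_neg_vadd_mem, mem_ofPred_eq, mem_ofPred_eq,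
      show -γ +ᵥ x = x + (-γ : E) from add_comm _ _, hp x _ (neg_mem γ.2)]
  refine hD.measure_zero_of_invariant {x | ¬ p x} hinv ?_
  rwa [ae_iff, Measure.restrict_apply₀' hD.nullMeasurableSet] at h

variable [NormedSpace ℝ E] [FiniteDimensional ℝ E] (Γ : Submodule ℤ E) [DiscreteTopology Γ]
  [IsZLattice ℝ Γ]

theorem exists_clm_eq_on_lattice {W : Type*} [NormedAddCommGroup W] [NormedSpace ℝ W]
    (φ : Γ →+ W) : ∃ L : E →L[ℝ] W, ∀ γ : Γ, L γ = φ γ := by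
  let b := Module.Free.chooseBasis ℤ Γ
  let L := (b.ofZLatticeBasis ℝ Γ).constr ℝ fun i => φ (b i)
  have hL : (L.restrictScalars ℤ).comp Γ.subtype = φ.toIntLinearMap := b.ext fun i => by
    have h := (b.ofZLatticeBasis ℝ Γ).constr_basis ℝ (fun i => φ (b i)) i
    rwa [b.ofZLatticeBasis_apply ℝ Γ] at h
  exact ⟨LinearMap.toContinuousLinearMap L, LinearMap.congr_fun hL⟩

variable {Γ}

theorem HasPeriods.exists_lipschitzWith {W : Type*} [NormedAddCommGroup W] [NormedSpace ℝ W]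
    {F : E → W} {L : E →L[ℝ] W} (hF : ContDiff ℝ 1 F) (hL : HasPeriods Γ F L) :
    ∃ K, LipschitzWith K F := by
  obtain ⟨C, hC⟩ := (IsZLattice.isCompact_range_of_periodic Γ (fderiv ℝ F)
    (hF.continuous_fderiv one_ne_zero) fun x γ hγ => hL.fderiv_add x hγ).isBounded.exists_norm_le
  exact ⟨C.toNNReal, lipschitzWith_of_nnnorm_fderiv_le (hF.differentiable one_ne_zero) fun x =>
    NNReal.coe_le_coe.1 ((hC _ (mem_range_self x)).trans (Real.le_coe_toNNReal C))⟩

theorem compContinuousLinearMap_periods_eq {W : Type*} [NormedAddCommGroup W] [NormedSpace ℝ W]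
    [FiniteDimensional ℝ W] {k : ℕ} {α : W [⋀^Fin (k + 1)]→L[ℝ] ℝ} {β : E [⋀^Fin (k + 1)]→L[ℝ] ℝ}
    {G : E → W} {L : E →L[ℝ] W} (hG : ContDiff ℝ 1 G) (hL : HasPeriods Γ G L)
    {η : E → E [⋀^Fin k]→L[ℝ] ℝ} (hη : ContDiff ℝ 1 η) (hηΓ : HasPeriods Γ η 0)
    (h : ∀ x, α.compContinuousLinearMap (fderiv ℝ G x) - β = extDeriv η x) :
    α.compContinuousLinearMap L = β := by
  let _ : MeasurableSpace E := borel E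
  have : BorelSpace E := ⟨rfl⟩
  let μ : Measure E := Measure.addHaar
  let b := Module.Free.chooseBasis ℤ Γ
  have hD := ZLattice.isAddFundamentalDomain b μ
  set D := ZSpan.fundamentalDomain (b.ofZLatticeBasis ℝ Γ)
  have hfin : μ D ≠ ⊤ := (ZSpan.fundamentalDomain_isBounded _).measure_lt_top.ne
  obtain ⟨K, hK⟩ := hL.exists_lipschitzWith hG
  obtain ⟨K', hK'⟩ := hηΓ.exists_lipschitzWith hη
  ext v
  have hnull := (IsNullLagrangian.compContinuousLinearMap hD hfin α v).add hfin (.const (-β v))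
  have hint : μ.real D * (α.compContinuousLinearMap L v + -β v) = 0 := by
    rw [← hnull.setIntegral_eq hK hL, ← setIntegral_extDeriv_eq_zero hD hfin hK' hηΓ v]
    simp_rw [← h, ContinuousAlternatingMap.sub_apply, sub_eq_add_neg]
  have hμD : μ.real D ≠ 0 :=
    ENNReal.toReal_ne_zero.2 ⟨ZSpan.measure_fundamentalDomain_ne_zero _, hfin⟩
  exact add_neg_eq_zero.1 ((mul_eq_zero.1 hint).resolve_left hμD)

end Lattice

section Lift

open scoped unitInterval

variable {Γ : Submodule ℤ ℍ}

theorem proj_eq_proj_iff {x y : ℍ} : proj Γ x = proj Γ y ↔ x - y ∈ Γ := by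
  rw [eq_comm, proj, proj, QuotientAddGroup.eq, neg_add_eq_sub]
  rfl

theorem proj_add {x γ : ℍ} (hγ : γ ∈ Γ) : proj Γ (x + γ) = proj Γ x :=
  proj_eq_proj_iff.2 (by rwa [add_sub_cancel_left])

theorem continuous_proj : Continuous (proj Γ) := continuous_quotient_mk'

theorem proj_surjective : Function.Surjective (proj Γ) := QuotientAddGroup.mk_surjective

/-- `F : ℍ → ℍ` is a lift of the map `f : M → M` of the torus to its universal covering. -/
structure IsLift (F : ℍ → ℍ) (f : Torus Γ → Torus Γ) : Prop where
  continuous : Continuous F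
  proj_apply (y : ℍ) : proj Γ (F y) = f (proj Γ y)

variable [DiscreteTopology Γ] {f : Torus Γ → Torus Γ} {F : ℍ → ℍ}

variable (Γ) in
theorem isDiscrete_lattice : IsDiscrete (Γ : Set ℍ) := isDiscrete_iff_discreteTopology.2 ‹_›

theorem isCoveringMap_proj : IsCoveringMap (proj Γ) :=
  (AddSubgroup.isAddQuotientCoveringMap_of_comm Γ.toAddSubgroup
    (isDiscrete_lattice Γ)).isCoveringMap

theorem eventually_eq_of_eventually_mem_lattice {X : Type*} [TopologicalSpace X] {d : X → ℍ}
    {x : X} (hd : ContinuousAt d x) (hmem : ∀ᶠ y in 𝓝 x, d y ∈ Γ) : ∀ᶠ y in 𝓝 x, d y = d x := by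
  have htendsto : Tendsto d (𝓝 x) (𝓝[(Γ : Set ℍ)] (d x)) :=
    tendsto_nhdsWithin_of_tendsto_nhds_of_eventually_within _ hd hmem
  rw [isDiscrete_iff_nhdsWithin.1 (isDiscrete_lattice Γ) _ hmem.self_of_nhds] at htendsto
  exact tendsto_pure.1 htendsto

theorem eq_of_proj_eq_of_hasFDerivAt {G H : ℍ → ℍ} {x : ℍ} {L M : ℍ →L[ℝ] ℍ}
    (hG : HasFDerivAt G L x) (hH : HasFDerivAt H M x)
    (hGH : ∀ᶠ y in 𝓝 x, proj Γ (G y) = proj Γ (H y)) : L = M := by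
  have hsub := hG.sub hH
  have hconst := eventually_eq_of_eventually_mem_lattice (Γ := Γ) hsub.continuousAt
    (hGH.mono fun y hy => proj_eq_proj_iff.1 hy)
  exact sub_eq_zero.1 (hsub.unique ((hasFDerivAt_const _ x).congr_of_eventuallyEq hconst))

theorem HasTorusDerivAt.unique {x : Torus Γ} {L M : ℍ →L[ℝ] ℍ}
    (hL : HasTorusDerivAt Γ f x L) (hM : HasTorusDerivAt Γ f x M) : L = M := by
  obtain ⟨x₁, g₁, rfl, hg₁, hd₁⟩ := hL
  obtain ⟨x₂, g₂, hx₂, hg₂, hd₂⟩ := hM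
  obtain ⟨γ, hγ, rfl⟩ : ∃ γ ∈ Γ, x₂ = x₁ + γ :=
    ⟨x₂ - x₁, proj_eq_proj_iff.1 hx₂, (add_sub_cancel x₁ x₂).symm⟩
  refine eq_of_proj_eq_of_hasFDerivAt (Γ := Γ) hd₁ ((hasFDerivAt_comp_add_right γ).2 hd₂) ?_
  have htranslate : Tendsto (· + γ) (𝓝 x₁) (𝓝 (x₁ + γ)) := tendsto_id.add_const γ
  filter_upwards [hg₁, htranslate.eventually hg₂] with y hy₁ hy₂
  rw [hy₁, hy₂, proj_add hγ]

namespace IsLift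

theorem torusDeriv_proj (hF : IsLift F f) {x : ℍ} {L : ℍ →L[ℝ] ℍ} (hL : HasFDerivAt F L x) :
    torusDeriv Γ f (proj Γ x) = L := by
  have h : HasTorusDerivAt Γ f (proj Γ x) L := ⟨x, F, rfl, .of_forall hF.proj_apply, hL⟩
  have hex : ∃ L, HasTorusDerivAt Γ f (proj Γ x) L := ⟨L, h⟩
  rw [torusDeriv, dif_pos hex]
  exact hex.choose_spec.unique h

theorem add_sub_eq (hF : IsLift F f) {γ : ℍ} (hγ : γ ∈ Γ) (x y : ℍ) :
    F (x + γ) - F x = F (y + γ) - F y := by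
  have hcont := hF.continuous
  refine isPreconnected_univ.constant_of_mapsTo (isDiscrete_lattice Γ)
    (f := fun z => F (z + γ) - F z) (by fun_prop) (fun z _ => ?_) (mem_univ x) (mem_univ y)
  exact proj_eq_proj_iff.1 (by rw [hF.proj_apply, hF.proj_apply, proj_add hγ])

theorem exists_hasPeriods [IsZLattice ℝ Γ] (hF : IsLift F f) : ∃ L, HasPeriods Γ F L := by
  obtain ⟨L, hL⟩ := exists_clm_eq_on_lattice Γ (W := ℍ) <|
    AddMonoidHom.mk' (fun γ => F γ - F 0) fun γ δ => by
      have h := hF.add_sub_eq δ.2 (γ : ℍ) 0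
      rw [zero_add] at h
      rw [← h]
      simp
  refine ⟨L, fun x γ hγ => ?_⟩
  rw [← sub_eq_iff_eq_add', hF.add_sub_eq hγ x 0, zero_add]
  exact (hL ⟨γ, hγ⟩).symm

theorem exists_of_homotopic {f g : C(Torus Γ, Torus Γ)} (hfg : f.Homotopic g) {G : ℍ → ℍ}
    (hG : IsLift G g) {L : ℍ →L[ℝ] ℍ} (hL : HasPeriods Γ G L) :
    ∃ F, IsLift F f ∧ HasPeriods Γ F L := by
  obtain ⟨H⟩ := hfg.symm
  let G' : C(ℍ, ℍ) := ⟨G, hG.continuous⟩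
  let H' : C(I × ℍ, Torus Γ) :=
    ⟨fun p => H (p.1, proj Γ p.2), by have := continuous_proj (Γ := Γ); fun_prop⟩
  have h0 (a : ℍ) : H' (0, a) = proj Γ (G' a) := by simp [H', G', hG.proj_apply]
  let K := isCoveringMap_proj.liftHomotopy H' G' h0
  have hK (p : I × ℍ) : proj Γ (K p) = H (p.1, proj Γ p.2) :=
    congrFun (isCoveringMap_proj.liftHomotopy_lifts H' G' h0) p
  have hK0 (a : ℍ) : K (0, a) = G a := isCoveringMap_proj.liftHomotopy_zero H' G' h0 a
  refine ⟨fun x => K (1, x), ⟨by fun_prop, fun y => by simp [hK]⟩, fun x γ hγ => ?_⟩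
  have hcont : ContinuousOn (fun p : I × ℍ => K (p.1, p.2 + γ) - K p) univ := by fun_prop
  have hconst := isPreconnected_univ.constant_of_mapsTo (isDiscrete_lattice Γ) hcont
    (fun p _ => proj_eq_proj_iff.1 (by rw [hK, hK, proj_add hγ]))
    (mem_univ ((1 : I), x)) (mem_univ ((0 : I), x))
  simp only [hK0, hL x γ hγ, add_sub_cancel_left] at hconst
  exact sub_eq_iff_eq_add'.1 hconst

theorem compContinuousLinearMap_periods_eq [IsZLattice ℝ Γ] {k : ℕ}
    {α β : ℍ [⋀^Fin (k + 1)]→L[ℝ] ℝ} {g : Torus Γ → Torus Γ} {G : ℍ → ℍ} (hG : IsLift G g)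
    (hGsmooth : ContDiff ℝ 1 G) {L : ℍ →L[ℝ] ℍ} (hL : HasPeriods Γ G L)
    (h : Cohomologous Γ (pullback Γ g fun _ => α) fun _ => β) :
    α.compContinuousLinearMap L = β := by
  obtain ⟨η, hη, hηα⟩ := h
  refine PolyTorus.compContinuousLinearMap_periods_eq hGsmooth hL
    (hη.of_le (mod_cast le_top)) (fun x γ hγ => ?_) fun x => ?_
  · rw [proj_add hγ, _root_.zero_apply, add_zero]
  · rw [← hηα, pullback,
      hG.torusDeriv_proj (hGsmooth.differentiable one_ne_zero x).hasFDerivAt]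

end IsLift

end Lift

section SelfDual

theorem inner_mul_left_apply (p q v : ℍ) : ⟪p * q, v⟫ =
    (p.re * q.re - p.imI * q.imI - p.imJ * q.imJ - p.imK * q.imK) * v.re
      + (p.re * q.imI + p.imI * q.re + p.imJ * q.imK - p.imK * q.imJ) * v.imI
      + (p.re * q.imJ - p.imI * q.imK + p.imJ * q.re + p.imK * q.imI) * v.imJ
      + (p.re * q.imK + p.imI * q.imJ - p.imJ * q.imI + p.imK * q.re) * v.imK := by
  simp only [Quaternion.inner_def, Quaternion.re_mul, Quaternion.imI_mul, Quaternion.imJ_mul,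
    Quaternion.imK_mul, Quaternion.re_star, Quaternion.imI_star, Quaternion.imJ_star,
    Quaternion.imK_star]
  ring

theorem omegaV_apply (u v : ℍ) :
    omegaV ![u, v] = (u.re * v.imI - u.imI * v.re) - (u.imJ * v.imK - u.imK * v.imJ) := by
  change ⟪u * qi, v⟫ = _
  rw [inner_mul_left_apply]
  simp only [qi]
  ring

theorem omegaI_apply (u v : ℍ) :
    omegaI ![u, v] = (u.re * v.imI - u.imI * v.re) + (u.imJ * v.imK - u.imK * v.imJ) := by
  change ⟪qi * u, v⟫ = _
  rw [inner_mul_left_apply]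
  simp only [qi]
  ring

theorem omegaJ_apply (u v : ℍ) :
    omegaJ ![u, v] = (u.re * v.imJ - u.imJ * v.re) - (u.imI * v.imK - u.imK * v.imI) := by
  change ⟪qj * u, v⟫ = _
  rw [inner_mul_left_apply]
  simp only [qj]
  ring

theorem omegaK_apply (u v : ℍ) :
    omegaK ![u, v] = (u.re * v.imK - u.imK * v.re) + (u.imI * v.imJ - u.imJ * v.imI) := by
  change ⟪qk * u, v⟫ = _
  rw [inner_mul_left_apply]
  simp only [qk]
  ring

theorem omegaV_comp_apply (A : ℍ →L[ℝ] ℍ) (u v : ℍ) :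
    omegaV.compContinuousLinearMap A ![u, v] = omegaV ![A u, A v] := by
  rw [ContinuousAlternatingMap.compContinuousLinearMap_apply]
  congr 1
  funext i
  fin_cases i <;> rfl

theorem omegaV_one_qi : omegaV ![1, qi] = 1 := by
  rw [omegaV_apply]
  simp [qi]

theorem omegaV_qj_qk : omegaV ![qj, qk] = -1 := by
  rw [omegaV_apply]
  simp [qj, qk]

/-- The basis `1, i, j, k` of the quaternions. -/
def quaternionBasis : Module.Basis (Fin 4) ℝ ℍ :=
  .ofEquivFun
    { toFun := fun q => ![q.re, q.imI, q.imJ, q.imK]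
      invFun := fun a => ⟨a 0, a 1, a 2, a 3⟩
      left_inv := fun q => rfl
      right_inv := fun a => by funext i; fin_cases i <;> rfl
      map_add' := fun p q => by funext i; fin_cases i <;> rfl
      map_smul' := fun c q => by funext i; fin_cases i <;> rfl }

theorem quaternionBasis_repr (q : ℍ) (i : Fin 4) :
    quaternionBasis.repr q i = ![q.re, q.imI, q.imJ, q.imK] i := rfl

theorem coe_quaternionBasis : ⇑quaternionBasis = ![1, qi, qj, qk] := by
  funext i
  apply quaternionBasis.repr.injective
  ext j
  rw [Module.Basis.repr_self, quaternionBasis_repr]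
  fin_cases i <;> fin_cases j <;> simp [qi, qj, qk]

theorem alternating_two_swap (a : ℍ [⋀^Fin 2]→L[ℝ] ℝ) (u v : ℍ) : a ![u, v] = -a ![v, u] := by
  have hswap : ![v, u] ∘ Equiv.swap (0 : Fin 2) 1 = ![u, v] := by
    funext i
    fin_cases i <;> rfl
  rw [← hswap]
  exact a.toAlternatingMap.map_swap ![v, u] (by decide)

theorem alternating_two_ext {a b : ℍ [⋀^Fin 2]→L[ℝ] ℝ}
    (h : ∀ i j : Fin 4, i < j →
      a ![quaternionBasis i, quaternionBasis j] = b ![quaternionBasis i, quaternionBasis j]) :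
    a = b := by
  apply ContinuousAlternatingMap.toAlternatingMap_injective
  refine Module.Basis.ext_alternating quaternionBasis fun v hv => ?_
  have hbasis : (fun k => quaternionBasis (v k))
      = ![quaternionBasis (v 0), quaternionBasis (v 1)] := by
    funext k
    fin_cases k <;> rfl
  rw [hbasis]
  change a _ = b _
  rcases lt_or_gt_of_ne (hv.ne zero_ne_one) with hlt | hlt
  · exact h _ _ hlt
  · rw [alternating_two_swap a, alternating_two_swap b, h _ _ hlt]

theorem wedge_frame (a b : ℍ [⋀^Fin 2]→L[ℝ] ℝ) : wedge a b ![1, qi, qj, qk] =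
    a ![1, qi] * b ![qj, qk] - a ![1, qj] * b ![qi, qk] + a ![1, qk] * b ![qi, qj]
      + a ![qi, qj] * b ![1, qk] - a ![qi, qk] * b ![1, qj] + a ![qj, qk] * b ![1, qi] := rfl

theorem wedge_omegaV_frame (a : ℍ [⋀^Fin 2]→L[ℝ] ℝ) :
    wedge a omegaV ![1, qi, qj, qk] = a ![qj, qk] - a ![1, qi] := by
  simp only [wedge_frame, omegaV_apply]
  simp only [qi, qj, qk, Quaternion.re_one, Quaternion.imI_one, Quaternion.imJ_one,
    Quaternion.imK_one]
  ring

theorem wedge_omegaI_frame (a : ℍ [⋀^Fin 2]→L[ℝ] ℝ) :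
    wedge a omegaI ![1, qi, qj, qk] = a ![1, qi] + a ![qj, qk] := by
  simp only [wedge_frame, omegaI_apply]
  simp only [qi, qj, qk, Quaternion.re_one, Quaternion.imI_one, Quaternion.imJ_one,
    Quaternion.imK_one]
  ring

theorem wedge_omegaJ_frame (a : ℍ [⋀^Fin 2]→L[ℝ] ℝ) :
    wedge a omegaJ ![1, qi, qj, qk] = a ![1, qj] - a ![qi, qk] := by
  simp only [wedge_frame, omegaJ_apply]
  simp only [qi, qj, qk, Quaternion.re_one, Quaternion.imI_one, Quaternion.imJ_one,
    Quaternion.imK_one]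
  ring

theorem wedge_omegaK_frame (a : ℍ [⋀^Fin 2]→L[ℝ] ℝ) :
    wedge a omegaK ![1, qi, qj, qk] = a ![1, qk] + a ![qi, qj] := by
  simp only [wedge_frame, omegaK_apply]
  simp only [qi, qj, qk, Quaternion.re_one, Quaternion.imI_one, Quaternion.imJ_one,
    Quaternion.imK_one]
  ring

/-- The self-dual `2`-forms for the orientation of `ℍ` given by `σ`, characterized as those which
are wedge-orthogonal to `ω̂_I`, `ω̂_J`, `ω̂_K`. The frame `1, i, j, k` is negatively oriented. -/
structure IsSelfDual (β : ℍ [⋀^Fin 2]→L[ℝ] ℝ) : Prop where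
  wedge_omegaI : wedge β omegaI ![1, qi, qj, qk] = 0
  wedge_omegaJ : wedge β omegaJ ![1, qi, qj, qk] = 0
  wedge_omegaK : wedge β omegaK ![1, qi, qj, qk] = 0

theorem wedge_sub_left (a b c : ℍ [⋀^Fin 2]→L[ℝ] ℝ) (v : Fin 4 → ℍ) :
    wedge (a - b) c v = wedge a c v - wedge b c v := by
  simp only [wedge, ContinuousAlternatingMap.sub_apply]
  ring

theorem IsSelfDual.sub {a b : ℍ [⋀^Fin 2]→L[ℝ] ℝ} (ha : IsSelfDual a) (hb : IsSelfDual b) :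
    IsSelfDual (a - b) where
  wedge_omegaI := by rw [wedge_sub_left, ha.wedge_omegaI, hb.wedge_omegaI, sub_zero]
  wedge_omegaJ := by rw [wedge_sub_left, ha.wedge_omegaJ, hb.wedge_omegaJ, sub_zero]
  wedge_omegaK := by rw [wedge_sub_left, ha.wedge_omegaK, hb.wedge_omegaK, sub_zero]

theorem isSelfDual_omegaV : IsSelfDual omegaV where
  wedge_omegaI := by
    rw [wedge_omegaI_frame, omegaV_apply, omegaV_apply]
    simp [qi, qj, qk]
  wedge_omegaJ := by
    rw [wedge_omegaJ_frame, omegaV_apply, omegaV_apply]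
    simp [qi, qj, qk]
  wedge_omegaK := by
    rw [wedge_omegaK_frame, omegaV_apply, omegaV_apply]
    simp [qi, qj, qk]

theorem IsSelfDual.wedge_self {β : ℍ [⋀^Fin 2]→L[ℝ] ℝ} (hβ : IsSelfDual β) :
    wedge β β ![1, qi, qj, qk] = -2 * (β ![1, qi] ^ 2 + β ![1, qj] ^ 2 + β ![1, qk] ^ 2) := by
  have hI := hβ.wedge_omegaI
  have hJ := hβ.wedge_omegaJ
  have hK := hβ.wedge_omegaK
  rw [wedge_omegaI_frame] at hI
  rw [wedge_omegaJ_frame] at hJ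
  rw [wedge_omegaK_frame] at hK
  rw [wedge_frame]
  linear_combination 2 * β ![1, qi] * hI + 2 * β ![1, qj] * hJ + 2 * β ![1, qk] * hK

theorem IsSelfDual.wedge_self_nonpos {β : ℍ [⋀^Fin 2]→L[ℝ] ℝ} (hβ : IsSelfDual β) :
    wedge β β ![1, qi, qj, qk] ≤ 0 := by
  rw [hβ.wedge_self]
  exact mul_nonpos_of_nonpos_of_nonneg (by norm_num) (by positivity)

theorem IsSelfDual.eq_zero_of_wedge_self_eq_zero {β : ℍ [⋀^Fin 2]→L[ℝ] ℝ} (hβ : IsSelfDual β)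
    (h : wedge β β ![1, qi, qj, qk] = 0) : β = 0 := by
  rw [hβ.wedge_self] at h
  have h₁i : β ![1, qi] = 0 := by nlinarith
  have h₁j : β ![1, qj] = 0 := by nlinarith
  have h₁k : β ![1, qk] = 0 := by nlinarith
  have hjk : β ![qj, qk] = 0 := by simpa [wedge_omegaI_frame, h₁i] using hβ.wedge_omegaI
  have hik : β ![qi, qk] = 0 := by simpa [wedge_omegaJ_frame, h₁j] using hβ.wedge_omegaJ
  have hij : β ![qi, qj] = 0 := by simpa [wedge_omegaK_frame, h₁k] using hβ.wedge_omegaK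
  refine alternating_two_ext fun i j hlt => ?_
  rw [coe_quaternionBasis]
  fin_cases i <;> fin_cases j <;> first | exact absurd hlt (by decide) | assumption

theorem moment_eq_wedge (omegaHat : ℍ [⋀^Fin 2]→L[ℝ] ℝ) (A : ℍ →L[ℝ] ℍ) : moment omegaHat A
    = wedge (omegaV.compContinuousLinearMap A) omegaHat ![1, qi, qj, qk] := by
  have hsigma : sigmaV ![1, qi, qj, qk] = -1 := by
    rw [sigmaV, wedge_omegaV_frame, omegaV_one_qi, omegaV_qj_qk]
    norm_num
  rw [moment, hsigma, div_neg, div_one, neg_neg]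

theorem isSelfDual_of_hyperMoment_eq_zero {A : ℍ →L[ℝ] ℍ} (hA : hyperMoment A = 0) :
    IsSelfDual (omegaV.compContinuousLinearMap A) := by
  simp only [hyperMoment, Prod.mk_eq_zero, moment_eq_wedge] at hA
  exact ⟨hA.1, hA.2.1, hA.2.2⟩

theorem wedge_comp_omegaV_frame (A : ℍ →L[ℝ] ℍ) : wedge (omegaV.compContinuousLinearMap A)
    (omegaV.compContinuousLinearMap A) ![1, qi, qj, qk] = -2 * A.det := by
  rw [ContinuousLinearMap.det, ← LinearMap.det_toMatrix quaternionBasis,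
    Matrix.det_succ_row_zero]
  simp only [wedge_frame, omegaV_comp_apply, omegaV_apply, Fin.sum_univ_succ,
    Matrix.det_fin_three, Matrix.submatrix_apply, LinearMap.toMatrix_apply, quaternionBasis_repr,
    coe_quaternionBasis]
  simp [Fin.succAbove]
  ring

theorem wedge_comp_omegaV_sub_frame (A : ℍ →L[ℝ] ℍ) :
    wedge (omegaV.compContinuousLinearMap A - omegaV) (omegaV.compContinuousLinearMap A - omegaV)
      ![1, qi, qj, qk] = -2 * A.det + (2 * omegaV.compContinuousLinearMap A ![1, qi]
        + (-2 * omegaV.compContinuousLinearMap A ![qj, qk] + -2)) := by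
  rw [← wedge_comp_omegaV_frame]
  have hcross := wedge_omegaV_frame (omegaV.compContinuousLinearMap A)
  have hself := wedge_omegaV_frame omegaV
  rw [omegaV_one_qi, omegaV_qj_qk] at hself
  rw [wedge_frame] at hcross hself
  simp only [wedge_frame, ContinuousAlternatingMap.sub_apply]
  linear_combination -2 * hcross + hself

section Integral

variable [MeasurableSpace ℍ] [BorelSpace ℍ] {μ : Measure ℍ} [μ.IsAddHaarMeasure]
  {Γ : Submodule ℤ ℍ} [Countable Γ] {D : Set ℍ}

theorem isNullLagrangian_wedge_comp_omegaV_sub (hD : IsAddFundamentalDomain Γ D μ)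
    (hfin : μ D ≠ ⊤) : IsNullLagrangian μ Γ D fun A : ℍ →L[ℝ] ℍ =>
      wedge (omegaV.compContinuousLinearMap A - omegaV) (omegaV.compContinuousLinearMap A - omegaV)
        ![1, qi, qj, qk] := by
  simp_rw [wedge_comp_omegaV_sub_frame]
  exact ((IsNullLagrangian.det_comp hD hfin (ContinuousLinearMap.id ℝ ℍ)).const_mul (-2)).add hfin
    (((IsNullLagrangian.compContinuousLinearMap hD hfin omegaV ![1, qi]).const_mul 2).add hfin
      (((IsNullLagrangian.compContinuousLinearMap hD hfin omegaV ![qj, qk]).const_mul (-2)).add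
        hfin (.const (-2))))

theorem ae_comp_omegaV_eq (hD : IsAddFundamentalDomain Γ D μ) (hfin : μ D ≠ ⊤) {F : ℍ → ℍ}
    {K : ℝ≥0} (hF : LipschitzWith K F) {L : ℍ →L[ℝ] ℍ} (hL : HasPeriods Γ F L)
    (hω : omegaV.compContinuousLinearMap L = omegaV)
    (hmoment : ∀ᵐ x ∂μ, hyperMoment (fderiv ℝ F x) = 0) :
    ∀ᵐ x ∂μ, omegaV.compContinuousLinearMap (fderiv ℝ F x) = omegaV := by
  have hnull := isNullLagrangian_wedge_comp_omegaV_sub hD hfin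
  let β (x : ℍ) : ℍ [⋀^Fin 2]→L[ℝ] ℝ := omegaV.compContinuousLinearMap (fderiv ℝ F x) - omegaV
  have hβ : ∀ᵐ x ∂μ.restrict D, IsSelfDual (β x) := by
    filter_upwards [ae_restrict_of_ae hmoment] with x hx
    exact (isSelfDual_of_hyperMoment_eq_zero hx).sub isSelfDual_omegaV
  have hint : ∫ x in D, wedge (β x) (β x) ![1, qi, qj, qk] ∂μ = 0 := by
    refine (hnull.setIntegral_eq hF hL).trans ?_
    simp only [hω]
    rw [wedge_sub_left, sub_self, mul_zero]
  have hzero := (integral_eq_zero_iff_of_nonneg_ae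
    (hβ.mono fun x hx => neg_nonneg.2 hx.wedge_self_nonpos)
    (integrableOn_comp_fderiv hfin hnull.continuous hF).neg).1
    (by rw [integral_neg, hint, neg_zero])
  refine ae_of_ae_restrict_of_add_mem hD (fun x γ hγ => by rw [hL.fderiv_add x hγ]) ?_
  filter_upwards [hzero, hβ] with x hx hβx
  exact sub_eq_zero.1 (hβx.eq_zero_of_wedge_self_eq_zero (neg_eq_zero.1 hx))

end Integral

end SelfDual

section PiecewiseLipschitz

variable {W ι : Type*} [PseudoMetricSpace W] {K : ℝ≥0}

theorem frequently_slope_dist_le_of_locallyFinite_cover {φ : ℝ → W} {C : ι → Set ℝ}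
    (hC : LocallyFinite C) (hclosed : ∀ i, IsClosed (C i)) (hcover : ∀ t, ∃ i, t ∈ C i)
    (hK : ∀ i, LipschitzOnWith K φ (C i)) (a t : ℝ) :
    ∃ᶠ z in 𝓝[>] t, slope (fun u => dist (φ u) (φ a)) t z ≤ K := by
  obtain ⟨U, hU, hfin⟩ := hC t
  have hev : ∀ᶠ z in 𝓝[>] t, ∃ i ∈ {i | (C i ∩ U).Nonempty}, z ∈ C i := by
    filter_upwards [nhdsWithin_le_nhds hU] with z hz
    obtain ⟨i, hi⟩ := hcover z
    exact ⟨i, ⟨z, hi, hz⟩, hi⟩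
  -- One of the finitely many pieces near `t` accumulates at `t` from the right.
  obtain ⟨i, -, hi⟩ := (frequently_exists_finite hfin).1 hev.frequently
  have ht : t ∈ C i := (hclosed i).mem_of_frequently_of_tendsto hi nhdsWithin_le_nhds
  refine (hi.and_eventually self_mem_nhdsWithin).mono fun z ⟨hz, hzt⟩ => ?_
  have hzt : 0 < z - t := sub_pos.2 hzt
  rw [slope_def_field, div_le_iff₀ hzt, ← abs_of_pos hzt, ← Real.dist_eq]
  exact (sub_le_iff_le_add.2 (dist_triangle _ _ _)).trans ((hK i).dist_le_mul z hz t ht)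

theorem lipschitzWith_real_of_locallyFinite_cover {φ : ℝ → W} (hφ : Continuous φ) {C : ι → Set ℝ}
    (hC : LocallyFinite C) (hclosed : ∀ i, IsClosed (C i)) (hcover : ∀ t, ∃ i, t ∈ C i)
    (hK : ∀ i, LipschitzOnWith K φ (C i)) : LipschitzWith K φ := by
  refine LipschitzWith.of_dist_le_mul fun b a => ?_
  wlog hab : a ≤ b generalizing a b
  · rw [dist_comm, dist_comm b]
    exact this a b (le_of_not_ge hab)
  rw [Real.dist_eq, abs_of_nonneg (sub_nonneg.2 hab)]
  have hderiv (t : ℝ) : HasDerivAt (fun t => K * (t - a)) K t := by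
    simpa using ((hasDerivAt_id t).sub_const a).const_mul (K : ℝ)
  refine image_le_of_liminf_slope_right_le_deriv_boundary
    (f := fun t => dist (φ t) (φ a)) (by fun_prop) (by simp) (by fun_prop)
    (fun t _ => (hderiv t).hasDerivWithinAt) (fun t _ r hr => ?_) (right_mem_Icc.2 hab)
  exact (frequently_slope_dist_le_of_locallyFinite_cover hC hclosed hcover hK a t).mono
    fun z hz => hz.trans_lt hr

theorem lipschitzWith_of_locallyFinite_cover {E : Type*} [NormedAddCommGroup E] [NormedSpace ℝ E]
    {F : E → W} (hF : Continuous F) {C : ι → Set E} (hC : LocallyFinite C)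
    (hclosed : ∀ i, IsClosed (C i)) (hcover : ∀ x, ∃ i, x ∈ C i)
    (hK : ∀ i, LipschitzOnWith K F (C i)) : LipschitzWith K F := by
  refine LipschitzWith.of_dist_le_mul fun x y => ?_
  have hline : LipschitzWith (nndist x y) (AffineMap.lineMap x y : ℝ → E) :=
    lipschitzWith_lineMap x y
  have hLip := lipschitzWith_real_of_locallyFinite_cover (hF.comp hline.continuous)
    (hC.preimage_continuous hline.continuous) (fun i => (hclosed i).preimage hline.continuous)
    (fun t => hcover _) fun i => (hK i).comp hline.lipschitzOnWith (mapsTo_preimage _ _)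
  simpa using hLip.dist_le_mul 0 1

end PiecewiseLipschitz

section Simplex

variable {E : Type*} [NormedAddCommGroup E] [NormedSpace ℝ E] [FiniteDimensional ℝ E]

theorem exists_facet_of_notMem_interior_convexHull {s : Finset E}
    (hs : AffineIndependent ℝ ((↑) : s → E)) (hcard : s.card = Module.finrank ℝ E + 1) {y : E}
    (hy : y ∈ convexHull ℝ (s : Set E)) (hint : y ∉ interior (convexHull ℝ (s : Set E))) :
    ∃ t ⊆ s, t.card + 1 = s.card ∧ y ∈ convexHull ℝ (t : Set E) := by
  classical
  let b : AffineBasis s ℝ E :=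
    ⟨_, hs, (hs.affineSpan_eq_top_iff_card_eq_finrank_add_one).2 (by rwa [Fintype.card_coe])⟩
  have hb : range b = (s : Set E) := Subtype.range_coe
  have hnonneg : ∀ i, 0 ≤ b.coord i y := by
    rwa [← hb, b.convexHull_eq_nonneg_coord] at hy
  obtain ⟨i, hi⟩ : ∃ i, b.coord i y = 0 := by
    by_contra! hne
    rw [← hb, b.interior_convexHull] at hint
    exact hint fun i => (hnonneg i).lt_of_ne' (hne i)
  refine ⟨s.erase i, Finset.erase_subset _ _, Finset.card_erase_add_one i.2, ?_⟩
  rw [← b.linear_combination_coord_eq_self y,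
    ← Finset.sum_erase Finset.univ (a := i) (by rw [hi, zero_smul])]
  refine (convex_convexHull ℝ _).sum_mem (fun j _ => hnonneg j) ?_ fun j hj =>
    subset_convexHull ℝ _ ?_
  · rw [Finset.sum_erase (f := fun j => b.coord j y) _ hi, b.sum_coord_apply_eq_one]
  · exact Finset.mem_coe.2 <| Finset.mem_erase.2
      ⟨fun h => (Finset.mem_erase.1 hj).1 (Subtype.ext h), j.2⟩

theorem measure_convexHull_eq_zero_of_card_le_finrank [MeasurableSpace E] [BorelSpace E]
    (μ : Measure E) [μ.IsAddHaarMeasure] {s : Finset E} (hcard : s.card ≤ Module.finrank ℝ E) :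
    μ (convexHull ℝ (s : Set E)) = 0 := by
  obtain rfl | hs := s.eq_empty_or_nonempty
  · simp
  refine measure_mono_null (convexHull_subset_affineSpan _)
    (Measure.addHaar_affineSubspace μ _ fun htop => ?_)
  obtain ⟨n, hn⟩ := Nat.exists_eq_add_one_of_ne_zero hs.card_pos.ne'
  have hle := finrank_vectorSpan_range_le ℝ ((↑) : s → E) (by rwa [Fintype.card_coe])
  have hspan : vectorSpan ℝ (range ((↑) : s → E)) = ⊤ := by
    rw [Subtype.range_coe]
    exact AffineSubspace.vectorSpan_eq_top_of_affineSpan_eq_top ℝ E E htop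
  rw [hspan, finrank_top] at hle
  omega

theorem locallyFinite_lattice_translates {κ : Type*} [Finite κ] {Γ : Submodule ℤ E}
    [DiscreteTopology Γ] {C : κ → Set E} (hC : ∀ i, Bornology.IsBounded (C i)) :
    LocallyFinite fun p : κ × Γ => {x | x - (p.2 : E) ∈ C p.1} := by
  intro x
  have : DiscreteTopology Γ.toAddSubgroup := ‹DiscreteTopology Γ›
  have hclosed : IsClosed (Γ : Set E) := AddSubgroup.isClosed_of_discrete (H := Γ.toAddSubgroup)
  have hbdd : Bornology.IsBounded (Metric.ball x 1 - ⋃ i, C i) :=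
    Metric.isBounded_ball.sub (Bornology.isBounded_iUnion.2 hC)
  have hfin := Metric.finite_isBounded_inter_isClosed
    (isDiscrete_iff_discreteTopology.2 ‹DiscreteTopology Γ›) hbdd hclosed
  refine ⟨Metric.ball x 1, Metric.ball_mem_nhds x one_pos,
    (finite_univ.prod (hfin.preimage Subtype.val_injective.injOn)).subset ?_⟩
  rintro ⟨i, γ⟩ ⟨y, hy, hyx⟩
  exact ⟨mem_univ _, ⟨y, hyx, y - γ, mem_iUnion.2 ⟨i, hy⟩, sub_sub_cancel y _⟩, γ.2⟩

end Simplex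

section Polyhedral

variable {Γ : Submodule ℤ ℍ} {T : EuclideanTriangulation Γ} {σ : Set (Torus Γ)} {s : Finset ℍ}

theorem EuclideanTriangulation.exists_mem_cell (T : EuclideanTriangulation Γ) (x : Torus Γ) :
    ∃ σ ∈ T.cells, x ∈ σ :=
  mem_sUnion.1 (T.cover ▸ mem_univ x)

theorem IsSimplexLift.exists_sub_mem_convexHull (hs : IsSimplexLift Γ s σ) {x : ℍ}
    (hx : proj Γ x ∈ σ) : ∃ γ ∈ Γ, x - γ ∈ convexHull ℝ (s : Set ℍ) := by
  obtain ⟨y, hy, hyx⟩ := hs.2.2.surjOn hx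
  exact ⟨x - y, proj_eq_proj_iff.1 hyx.symm, by rwa [sub_sub_cancel]⟩

theorem IsSimplexLift.image_of_subset (hs : IsSimplexLift Γ s σ) {t : Finset ℍ} (hts : t ⊆ s)
    (ht : t.Nonempty) : IsSimplexLift Γ t (proj Γ '' convexHull ℝ (t : Set ℍ)) :=
  ⟨ht, hs.2.1.mono hts, (hs.2.2.injOn.mono (convexHull_mono hts)).bijOn_image⟩

theorem EuclideanTriangulation.proj_mem_skeleton (hσ : σ ∈ T.cells) (hs : IsSimplexLift Γ s σ)
    {t : Finset ℍ} (hts : t ⊆ s) {k : ℕ} (hcard : t.card ≤ k + 1) {y : ℍ}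
    (hy : y ∈ convexHull ℝ (t : Set ℍ)) : proj Γ y ∈ T.skeleton k := by
  have ht : t.Nonempty := Finset.coe_nonempty.1 (convexHull_nonempty_iff.1 ⟨y, hy⟩)
  have hface := hs.image_of_subset hts ht
  have hpos := ht.card_pos
  exact ⟨_, ⟨T.face_mem σ hσ _ ⟨s, hs, t, hts, hface⟩, t.card - 1, by omega, t, by omega, hface⟩,
    mem_image_of_mem _ hy⟩

theorem EuclideanTriangulation.mem_interior_of_notMem_skeleton (hσ : σ ∈ T.cells)
    (hs : IsSimplexLift Γ s σ) {y : ℍ} (hy : y ∈ convexHull ℝ (s : Set ℍ))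
    (hskel : proj Γ y ∉ T.skeleton 3) : y ∈ interior (convexHull ℝ (s : Set ℍ)) := by
  have hrank : Module.finrank ℝ ℍ = 4 := Quaternion.finrank_eq_four
  have hle : s.card ≤ 5 := by
    have h := hs.2.1.card_le_finrank_succ.trans (Nat.succ_le_succ (Submodule.finrank_le _))
    rwa [Fintype.card_coe, hrank] at h
  have hcard : s.card = 5 := by
    by_contra hne
    exact hskel (T.proj_mem_skeleton hσ hs subset_rfl (by omega) hy)
  by_contra hint
  obtain ⟨t, hts, htcard, hyt⟩ :=
    exists_facet_of_notMem_interior_convexHull hs.2.1 (by omega) hy hint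
  exact hskel (T.proj_mem_skeleton hσ hs hts (by omega) hyt)

theorem EuclideanTriangulation.measure_preimage_skeleton [MeasurableSpace ℍ] [BorelSpace ℍ]
    (μ : Measure ℍ) [μ.IsAddHaarMeasure] [Countable Γ] (T : EuclideanTriangulation Γ) :
    μ (proj Γ ⁻¹' T.skeleton 3) = 0 := by
  rw [EuclideanTriangulation.skeleton, preimage_sUnion]
  refine (measure_biUnion_null_iff (T.finite.subset (sep_subset _ _)).countable).2 ?_
  rintro σ ⟨-, m, hm, s, hcard, hs⟩
  have hcover : proj Γ ⁻¹' σ ⊆ ⋃ γ : Γ, (· - (γ : ℍ)) ⁻¹' convexHull ℝ (s : Set ℍ) := by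
    intro x hx
    obtain ⟨γ, hγ, hxγ⟩ := hs.exists_sub_mem_convexHull hx
    exact mem_iUnion.2 ⟨⟨γ, hγ⟩, hxγ⟩
  refine measure_mono_null hcover (measure_iUnion_null fun γ => ?_)
  simp only [sub_eq_add_neg]
  rw [measure_preimage_add_right]
  exact measure_convexHull_eq_zero_of_card_le_finrank μ (by
    rw [Quaternion.finrank_eq_four]
    omega)

namespace IsPolyhedral

variable [DiscreteTopology Γ] {f : C(Torus Γ, Torus Γ)} {F : ℍ → ℍ} {L : ℍ →L[ℝ] ℍ}

theorem lift_affine (hf : IsPolyhedral T f) (hF : IsLift F f) (hσ : σ ∈ T.cells) :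
    ∃ s : Finset ℍ, IsSimplexLift Γ s σ ∧ ∃ A : ℍ →L[ℝ] ℍ, ∀ γ ∈ Γ, ∃ c : ℍ,
      ∀ x, x - γ ∈ convexHull ℝ (s : Set ℍ) → F x = A x + c := by
  obtain ⟨s, hs, A, hA⟩ := hf σ hσ
  let A' : ℍ →L[ℝ] ℍ := LinearMap.toContinuousLinearMap A.linear
  have hAA' (x : ℍ) : A x = A' x + A 0 := congrFun A.decomp x
  refine ⟨s, hs, A', fun γ hγ => ?_⟩
  obtain ⟨x₀, hx₀⟩ : (convexHull ℝ (s : Set ℍ)).Nonempty := by simpa using hs.1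
  have hFcont := hF.continuous
  have hAcont : Continuous A := A.continuous_of_finiteDimensional
  have hconst (x) (hx : x - γ ∈ convexHull ℝ (s : Set ℍ)) :
      F (x - γ + γ) - A (x - γ) = F (x₀ + γ) - A x₀ :=
    (convex_convexHull ℝ (s : Set ℍ)).isPreconnected.constant_of_mapsTo (isDiscrete_lattice Γ)
      (f := fun z => F (z + γ) - A z) (by fun_prop)
      (fun z hz => proj_eq_proj_iff.1 (by rw [hF.proj_apply, proj_add hγ, hA z hz])) hx hx₀
  refine ⟨F (x₀ + γ) - A x₀ + A 0 - A' γ, fun x hx => ?_⟩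
  rw [← hconst x hx, sub_add_cancel, hAA' (x - γ), map_sub]
  abel

theorem exists_lipschitzWith_lift (hf : IsPolyhedral T f) (hF : IsLift F f) :
    ∃ K : ℝ≥0, LipschitzWith K F := by
  choose! s hs A hA using fun σ => hf.lift_affine hF (σ := σ)
  have := T.finite.to_subtype
  obtain ⟨K, hK⟩ := (finite_range fun σ : T.cells => ‖A σ‖₊).bddAbove
  refine ⟨K, lipschitzWith_of_locallyFinite_cover hF.continuous
    (locallyFinite_lattice_translates (Γ := Γ) (C := fun σ : T.cells => convexHull ℝ (s σ : Set ℍ))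
      fun σ => isBounded_convexHull.2 (s σ).finite_toSet.isBounded) ?_ ?_ ?_⟩
  · rintro ⟨σ, γ⟩
    exact ((s σ).finite_toSet.isCompact_convexHull ℝ).isClosed.preimage
      (continuous_id.sub continuous_const)
  · intro x
    obtain ⟨σ, hσ, hx⟩ := T.exists_mem_cell (proj Γ x)
    obtain ⟨γ, hγ, hxγ⟩ := (hs σ hσ).exists_sub_mem_convexHull hx
    exact ⟨⟨⟨σ, hσ⟩, ⟨γ, hγ⟩⟩, hxγ⟩
  · rintro ⟨σ, γ⟩
    obtain ⟨c, hc⟩ := hA σ σ.2 γ γ.2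
    refine LipschitzOnWith.of_dist_le_mul fun x hx y hy => ?_
    rw [hc x hx, hc y hy, dist_add_right]
    exact ((A σ).lipschitz.weaken (hK (mem_range_self σ))).dist_le_mul x y

theorem exists_eventually_hasFDerivAt (hf : IsPolyhedral T f) (hF : IsLift F f) {x : ℍ}
    (hx : proj Γ x ∉ T.skeleton 3) : ∃ A : ℍ →L[ℝ] ℍ, ∀ᶠ z in 𝓝 x, HasFDerivAt F A z := by
  obtain ⟨σ, hσ, hxσ⟩ := T.exists_mem_cell (proj Γ x)
  obtain ⟨s, hs, A, hA⟩ := hf.lift_affine hF hσ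
  obtain ⟨γ, hγ, hxγ⟩ := hs.exists_sub_mem_convexHull hxσ
  obtain ⟨c, hc⟩ := hA γ hγ
  have hproj : proj Γ (x - γ) = proj Γ x := by rw [sub_eq_add_neg, proj_add (neg_mem hγ)]
  have hint := T.mem_interior_of_notMem_skeleton hσ hs hxγ (hproj ▸ hx)
  have hcont : ContinuousAt (· - γ) x := (continuous_id.sub continuous_const).continuousAt
  have hev : ∀ᶠ z in 𝓝 x, F z = A z + c :=
    (hcont.eventually (mem_interior_iff_mem_nhds.1 hint)).mono hc
  exact ⟨A, hev.eventually_nhds.mono fun z hz =>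
    (A.hasFDerivAt.add_const c).congr_of_eventuallyEq hz⟩

theorem ae_comp_omegaV_fderiv_eq [IsZLattice ℝ Γ] [MeasurableSpace ℍ] [BorelSpace ℍ]
    (μ : Measure ℍ) [μ.IsAddHaarMeasure] (hf : IsPolyhedral T f) (hF : IsLift F f)
    (hL : HasPeriods Γ F L) (hω : omegaV.compContinuousLinearMap L = omegaV)
    (hmoment : ∀ x ∉ T.skeleton 3, hyperMoment (torusDeriv Γ f x) = 0) :
    ∀ᵐ x ∂μ, omegaV.compContinuousLinearMap (fderiv ℝ F x) = omegaV := by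
  let b := Module.Free.chooseBasis ℤ Γ
  obtain ⟨K, hK⟩ := hf.exists_lipschitzWith_lift hF
  refine ae_comp_omegaV_eq (ZLattice.isAddFundamentalDomain b μ)
    (ZSpan.fundamentalDomain_isBounded _).measure_lt_top.ne hK hL hω ?_
  filter_upwards [measure_eq_zero_iff_ae_notMem.1 (T.measure_preimage_skeleton μ)] with x hx
  obtain ⟨A, hA⟩ := hf.exists_eventually_hasFDerivAt hF hx
  rw [← hF.torusDeriv_proj hA.self_of_nhds.differentiableAt.hasFDerivAt]
  exact hmoment _ hx

theorem pullback_omegaM_eq [IsZLattice ℝ Γ] (hf : IsPolyhedral T f) (hF : IsLift F f)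
    (hL : HasPeriods Γ F L) (hω : omegaV.compContinuousLinearMap L = omegaV)
    (hmoment : ∀ x ∉ T.skeleton 3, hyperMoment (torusDeriv Γ f x) = 0) {x : ℍ}
    (hx : proj Γ x ∉ T.skeleton 3) : pullback Γ f (omegaM Γ) (proj Γ x) = omegaV := by
  let _ : MeasurableSpace ℍ := borel ℍ
  have : BorelSpace ℍ := ⟨rfl⟩
  obtain ⟨A, hA⟩ := hf.exists_eventually_hasFDerivAt hF hx
  have hdense := Measure.dense_of_ae (hf.ae_comp_omegaV_fderiv_eq Measure.addHaar hF hL hω hmoment)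
  obtain ⟨z, hz, hzA⟩ := hdense.inter_nhds_nonempty hA
  rw [pullback, hF.torusDeriv_proj hA.self_of_nhds, ← hzA.fderiv]
  exact hz

end IsPolyhedral

end Polyhedral

end PolyTorus

end

theorem mainTheorem8 (Γ : Submodule ℤ ℍ) [DiscreteTopology Γ] [IsZLattice ℝ Γ]
    (T : PolyTorus.EuclideanTriangulation Γ)
    (f : C(PolyTorus.Torus Γ, PolyTorus.Torus Γ)) (hf : PolyTorus.IsPolyhedral T f)
    (hclass : PolyTorus.PullbackClassEq Γ f (PolyTorus.omegaM Γ) (PolyTorus.omegaM Γ))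
    (hmoment : ∀ x ∉ T.skeleton 3, PolyTorus.hyperMoment (PolyTorus.torusDeriv Γ f x) = 0) :
    PolyTorus.IsSymplecticPolyhedral T f := by
  obtain ⟨g, ⟨G, hG, hgG⟩, hfg, hcoh⟩ := hclass
  have hGlift : PolyTorus.IsLift G g := ⟨hG.continuous, fun y => (hgG y).symm⟩
  obtain ⟨L, hGL⟩ := hGlift.exists_hasPeriods
  have hω : PolyTorus.omegaV.compContinuousLinearMap L = PolyTorus.omegaV :=
    hGlift.compContinuousLinearMap_periods_eq (hG.of_le (mod_cast le_top)) hGL hcoh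
  obtain ⟨F, hF, hFL⟩ := PolyTorus.IsLift.exists_of_homotopic hfg hGlift hGL
  exact ⟨hf, PolyTorus.proj_surjective.forall.2 fun x hx =>
    hf.pullback_omegaM_eq hF hFL hω hmoment hx⟩
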